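/- Let $\Bbbk$ be a field and let $L\subset\mathbb Z^n$ be a lattice, i.e. a subgroup of $\mathbb Z^n$ (of any rank). The lattice ideal of $L$ is $I_L=\langle x^u-x^v : u,v\in\mathbb N^n,\ u-v\in L\rangle\subset \Bbbk[x_1,\dots,x_n]$. By a binomial we mean a polynomial of the form $x^u-x^v$, and $\mu(I_L)$ denotes the least cardinality of a generating set of $I_L$ consisting of binomials. Let $L^+=L\cap\mathbb N^n$, let $\sigma=\sigma_L\subset\{1,\dots,n\}$ be the set of all $i$ such that $u_i\neq0$ for some $u\in L^+$, and let $L_{pure}$ be the subgroup of $L$ generated by $L^+$. Let $L^\sigma=\{(u_i)_{i\notin\sigma} : u\in L\}\subset\mathbb Z^{\{1,\dots,n\}\setminus\sigma}$ be the projection of $L$ to the coordinates outside $\sigma$, with its lattice ideal $I_{L^\sigma}\subset\Bbbk[x_i : i\notin\sigma]$. Then $L^\sigma$ is positively graded, i.e. its only vector with all coordinates nonnegative is $\mathbf 0$; the numbers $\mu(I_L)$ and $\mu(I_{L^\sigma})$ are finite; and $$\mu(I_L)=\mu(I_{L^\sigma})+\operatorname{rank}(L_{pure}).$$ -/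

import Mathlib

namespace BinomialLattice

/-- The set `L⁺ = L ∩ ℕ^ι` of vectors of the lattice `L ⊆ ℤ^ι` with nonnegative coordinates.
A lattice is an arbitrary subgroup of `ℤ^ι`, of any rank. -/
def plus {ι : Type*} (L : AddSubgroup (ι → ℤ)) : Set (ι → ℤ) :=
  {u | u ∈ L ∧ ∀ i, 0 ≤ u i}

/-- `L` is positively graded: `L ∩ ℕ^ι = {0}`. -/
def IsPositivelyGraded {ι : Type*} (L : AddSubgroup (ι → ℤ)) : Prop :=
  plus L = {0}

/-- The support `σ_L` of `L⁺`: the union of the supports of its elements. -/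
def sigma {ι : Type*} (L : AddSubgroup (ι → ℤ)) : Set ι :=
  ⋃ u ∈ plus L, Function.support u

/-- `L_pure`, the subgroup of `L` generated by `L⁺`. -/
def purePart {ι : Type*} (L : AddSubgroup (ι → ℤ)) : AddSubgroup (ι → ℤ) :=
  AddSubgroup.closure (plus L)

/-- The coordinate projection `u ↦ u^s = (u_i)_{i ∉ s}` that forgets the coordinates in `s`. -/
def outside {ι : Type*} (s : Set ι) : (ι → ℤ) →+ ({i : ι // i ∉ s} → ℤ) where
  toFun u := fun i => u i.1
  map_zero' := rfl
  map_add' _ _ := rfl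

/-- `L^σ`: the image of `L` under the projection to the coordinates outside `σ_L`. -/
def projOutside {ι : Type*} (L : AddSubgroup (ι → ℤ)) :
    AddSubgroup ({i : ι // i ∉ sigma L} → ℤ) :=
  L.map (outside (sigma L))

/-- The binomial `x^u - x^v`. -/
noncomputable def binomial (k : Type*) [Field k] {ι : Type*} (u v : ι →₀ ℕ) :
    MvPolynomial ι k :=
  MvPolynomial.monomial u 1 - MvPolynomial.monomial v 1

/-- The lattice ideal `I_L = ⟨x^u - x^v : u - v ∈ L⟩` in the polynomial ring
`k[x_i : i ∈ ι]`; the difference `u - v` is taken in `ℤ^ι`. -/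
noncomputable def latticeIdeal (k : Type*) [Field k] {ι : Type*}
    (L : AddSubgroup (ι → ℤ)) : Ideal (MvPolynomial ι k) :=
  Ideal.span {f | ∃ u v : ι →₀ ℕ, (fun i => (u i : ℤ) - (v i : ℤ)) ∈ L ∧ f = binomial k u v}

/-- `S` is a generating set of the ideal `J` that consists of binomials. -/
def IsBinomialGenerating {k : Type*} [Field k] {ι : Type*} (J : Ideal (MvPolynomial ι k))
    (S : Set (MvPolynomial ι k)) : Prop :=
  (∀ f ∈ S, ∃ u v : ι →₀ ℕ, f = binomial k u v) ∧ Ideal.span S = J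

/-- `μ(J)`: the least cardinality of a generating set of `J` consisting of binomials, with value
`⊤` if there is no finite one. A finite generating set of least cardinality is automatically
minimal with respect to inclusion, so this is also the least cardinality of a minimal
generating set of binomials. -/
noncomputable def mu {k : Type*} [Field k] {ι : Type*} (J : Ideal (MvPolynomial ι k)) : ℕ∞ :=
  ⨅ S : {S : Set (MvPolynomial ι k) // IsBinomialGenerating J S}, S.1.encard

end BinomialLattice

/-!
Modulo `I_L` a monomial is the same thing as a class of the congruence `u ~ v ↔ u - v ∈ L` on the
exponent monoid `ℕ^ι`, and a set of binomials generates `I_L` if and only if the corresponding pairs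
of exponents generate this congruence. Hence `μ(I_L)` does not depend on the field, and the
theorem is a count of generators of congruences.

Since `L^σ` is positively graded, no exponent supported in `σ` is congruent to one that is not. So
in any generating set the pairs supported in `σ` generate the congruence on `ℕ^σ`, and their
differences span `L_pure`, while the remaining pairs generate the congruence of `L^σ`. Conversely,
`L_pure` has a basis of nonnegative vectors `g`: some vector of `L⁺` is positive on all of `σ`, it
is a multiple of a vector of a basis, and multiples of this one are added to the others. The pairs
`(g, 0)` make every exponent supported in `σ` invertible, and together with arbitrary lifts of
generators for `L^σ` they generate the congruence of `L`.
-/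

namespace BinomialLattice

open MvPolynomial

section Congruences

variable {M N : Type*} [AddCommMonoid M] [AddCommMonoid N]

/-- The congruence generated by a set of pairs. -/
def conSpan (R : Set (M × M)) : AddCon M :=
  addConGen fun u v => (u, v) ∈ R

/-- The least number of pairs that generate a congruence, with value `⊤` if there is no finite set
of generators. -/
noncomputable def conRank (c : AddCon M) : ℕ∞ :=
  ⨅ R : {R : Set (M × M) // conSpan R = c}, R.1.encard

theorem conSpan_le {R : Set (M × M)} {c : AddCon M} :
    conSpan R ≤ c ↔ ∀ p ∈ R, c p.1 p.2 :=
  AddCon.addConGen_le.trans ⟨fun h p hp => h p.1 p.2 hp, fun h u v huv => h (u, v) huv⟩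

theorem conSpan_of_mem {R : Set (M × M)} {p : M × M} (hp : p ∈ R) : conSpan R p.1 p.2 :=
  conSpan_le.1 le_rfl p hp

theorem conRank_conSpan_le (R : Set (M × M)) : conRank (conSpan R) ≤ R.encard :=
  iInf_le (fun R' : {R' : Set (M × M) // conSpan R' = conSpan R} => R'.1.encard) ⟨R, rfl⟩

theorem rel_of_add_rel_add {c : AddCon M} {s s' u v : M} (hs : c (s + s') 0)
    (h : c (u + s) (v + s)) : c u v := by
  have absorb (w : M) : c (w + s + s') w := by
    simpa only [add_zero, add_assoc] using c.add (c.refl w) hs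
  exact c.trans (c.symm (absorb u)) (c.trans (c.add h (c.refl s')) (absorb v))

theorem conSpan_restrict_face {R : Set (M × M)} {F : AddSubmonoid M}
    (hface : ∀ a b, a + b ∈ F → a ∈ F ∧ b ∈ F) (hR : ∀ p ∈ R, p.1 ∈ F ↔ p.2 ∈ F) {u v : M}
    (h : conSpan R u v) : (u ∈ F ↔ v ∈ F) ∧ (u ∈ F → conSpan {p ∈ R | p.1 ∈ F} u v) := by
  have mem_add {a b : M} : a + b ∈ F ↔ a ∈ F ∧ b ∈ F :=
    ⟨hface a b, fun h => F.add_mem h.1 h.2⟩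
  induction h with
  | of u v huv => exact ⟨hR _ huv, fun hu => conSpan_of_mem (p := (u, v)) ⟨huv, hu⟩⟩
  | refl u => exact ⟨Iff.rfl, fun _ => AddCon.refl _ u⟩
  | symm _ ih => exact ⟨ih.1.symm, fun hu => AddCon.symm _ (ih.2 (ih.1.2 hu))⟩
  | trans _ _ ih ih' =>
    exact ⟨ih.1.trans ih'.1, fun hu => AddCon.trans _ (ih.2 hu) (ih'.2 (ih.1.1 hu))⟩
  | add _ _ ih ih' =>
    refine ⟨by rw [mem_add, mem_add, ih.1, ih'.1], fun hu => ?_⟩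
    exact AddCon.add _ (ih.2 (mem_add.1 hu).1) (ih'.2 (mem_add.1 hu).2)

theorem rel_of_conSpan_image {f : M →+ N} (hf : Function.Surjective f) {c : AddCon M}
    (hker : AddCon.ker f ≤ c) {R : Set (M × M)} (hR : conSpan R ≤ c) {u v : M}
    (h : conSpan (Prod.map f f '' R) (f u) (f v)) : c u v := by
  have hle : conSpan (Prod.map f f '' R) ≤ c.mapOfSurjective f hker hf := by
    rw [conSpan_le]
    rintro _ ⟨p, hp, rfl⟩
    exact ⟨p.1, p.2, conSpan_le.1 hR p hp, rfl, rfl⟩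
  obtain ⟨a, b, hab, ha, hb⟩ := hle h
  exact c.trans (hker ha.symm) (c.trans hab (hker hb))

/-- The congruence obtained from `c` by identifying the elements of the submonoid `S` with `0`. -/
def modCon (c : AddCon M) (S : AddSubmonoid M) : AddCon M where
  r u v := ∃ s ∈ S, ∃ t ∈ S, c (u + s) (v + t)
  iseqv :=
    { refl := fun u => ⟨0, S.zero_mem, 0, S.zero_mem, c.refl _⟩
      symm := fun ⟨s, hs, t, ht, h⟩ => ⟨t, ht, s, hs, c.symm h⟩
      trans := fun {u v w} ⟨s, hs, t, ht, h⟩ ⟨s', hs', t', ht', h'⟩ => by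
        refine ⟨s + s', S.add_mem hs hs', t' + t, S.add_mem ht' ht, ?_⟩
        rw [← add_assoc, ← add_assoc]
        refine c.trans (c.add h (c.refl s')) ?_
        rw [add_right_comm]
        exact c.add h' (c.refl t) }
  add' := fun {u v u' v'} ⟨s, hs, t, ht, h⟩ ⟨s', hs', t', ht', h'⟩ => by
    refine ⟨s + s', S.add_mem hs hs', t + t', S.add_mem ht ht', ?_⟩
    rw [add_add_add_comm, add_add_add_comm v]
    exact c.add h h'

theorem le_modCon (c : AddCon M) (S : AddSubmonoid M) : c ≤ modCon c S :=
  fun u v h => ⟨0, S.zero_mem, 0, S.zero_mem, by simpa only [add_zero] using h⟩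

end Congruences

section BinomialIdeals

variable {k : Type*} [Field k] {ι : Type*}

variable (k) in
/-- The ideal spanned by the binomials `x^u - x^v` with `u` and `v` congruent modulo `c`. -/
noncomputable def conIdeal (c : AddCon (ι →₀ ℕ)) : Ideal (MvPolynomial ι k) :=
  Ideal.span {f | ∃ u v : ι →₀ ℕ, c u v ∧ f = binomial k u v}

/-- The congruence that identifies exponents whose monomials agree modulo the ideal `J`. -/
noncomputable def idealCon (J : Ideal (MvPolynomial ι k)) : AddCon (ι →₀ ℕ) :=
  AddCon.ker ((Ideal.Quotient.mk J).toMonoidHom.comp (monomialOneHom k ι)).toAdditiveRight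

theorem idealCon_iff {J : Ideal (MvPolynomial ι k)} {u v : ι →₀ ℕ} :
    idealCon J u v ↔ binomial k u v ∈ J :=
  Ideal.Quotient.eq

theorem binomial_mem_conIdeal {c : AddCon (ι →₀ ℕ)} {u v : ι →₀ ℕ} :
    binomial k u v ∈ conIdeal k c ↔ c u v := by
  refine ⟨fun h => ?_, fun h => Ideal.subset_span ⟨u, v, h, rfl⟩⟩
  let φ : MvPolynomial ι k →+* AddMonoidAlgebra k c.Quotient :=
    AddMonoidAlgebra.mapDomainRingHom k c.mk'
  have φ_binomial (a b : ι →₀ ℕ) : φ (binomial k a b) =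
      AddMonoidAlgebra.single (a : c.Quotient) 1 - AddMonoidAlgebra.single (b : c.Quotient) 1 := by
    rw [binomial, map_sub]
    exact congrArg₂ _ AddMonoidAlgebra.mapDomain_single AddMonoidAlgebra.mapDomain_single
  have hle : conIdeal k c ≤ RingHom.ker φ := by
    refine Ideal.span_le.2 ?_
    rintro _ ⟨a, b, hab, rfl⟩
    rw [SetLike.mem_coe, RingHom.mem_ker, φ_binomial, (AddCon.eq c).2 hab, sub_self]
  have hφ := RingHom.mem_ker.1 (hle h)
  rw [φ_binomial, sub_eq_zero] at hφ
  exact (AddCon.eq c).1 (AddMonoidAlgebra.single_left_injective one_ne_zero hφ)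

theorem conIdeal_injective : Function.Injective (conIdeal k (ι := ι)) := fun c d h =>
  AddCon.ext fun u v => by rw [← binomial_mem_conIdeal (k := k), h, binomial_mem_conIdeal]

theorem span_binomial_image (R : Set ((ι →₀ ℕ) × (ι →₀ ℕ))) :
    Ideal.span (Function.uncurry (binomial k) '' R) = conIdeal k (conSpan R) := by
  refine le_antisymm (Ideal.span_le.2 ?_) (Ideal.span_le.2 ?_)
  · rintro _ ⟨p, hp, rfl⟩
    exact binomial_mem_conIdeal.2 (conSpan_of_mem hp)
  · rintro _ ⟨u, v, huv, rfl⟩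
    have hle : conSpan R ≤ idealCon (Ideal.span (Function.uncurry (binomial k) '' R)) :=
      conSpan_le.2 fun p hp => idealCon_iff.2 (Ideal.subset_span ⟨p, hp, rfl⟩)
    exact idealCon_iff.1 (hle huv)

theorem mu_le {J : Ideal (MvPolynomial ι k)} {S : Set (MvPolynomial ι k)}
    (hS : IsBinomialGenerating J S) : mu J ≤ S.encard :=
  iInf_le (fun S : {S : Set (MvPolynomial ι k) // IsBinomialGenerating J S} => S.1.encard) ⟨S, hS⟩

theorem mu_conIdeal (c : AddCon (ι →₀ ℕ)) : mu (conIdeal k c) = conRank c := by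
  refine le_antisymm (le_iInf ?_) (le_iInf ?_)
  · rintro ⟨R, rfl⟩
    refine (mu_le ⟨?_, span_binomial_image R⟩).trans (Set.encard_image_le _ R)
    rintro _ ⟨p, -, rfl⟩
    exact ⟨p.1, p.2, rfl⟩
  · rintro ⟨S, hS, hspan⟩
    have hsurj : Set.SurjOn (Function.uncurry (binomial k)) Set.univ S := fun f hf => by
      obtain ⟨u, v, rfl⟩ := hS f hf
      exact ⟨(u, v), trivial, rfl⟩
    obtain ⟨R, -, hR⟩ := hsurj.exists_bijOn_subset
    have hRc : conSpan R = c := conIdeal_injective (k := k) <| by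
      rw [← span_binomial_image, hR.image_eq, hspan]
    change conRank c ≤ S.encard
    rw [← hRc, ← hR.image_eq, hR.injOn.encard_image]
    exact conRank_conSpan_le R

theorem mu_conIdeal_ne_top [Finite ι] (c : AddCon (ι →₀ ℕ)) : mu (conIdeal k c) ≠ ⊤ := by
  obtain ⟨S, hS, hspan⟩ := (Submodule.fg_span_iff_fg_span_finset_subset _).1
    (IsNoetherian.noetherian (conIdeal k c))
  refine ne_top_of_le_ne_top S.finite_toSet.encard_lt_top.ne (mu_le ⟨fun f hf => ?_, hspan.symm⟩)
  obtain ⟨u, v, -, rfl⟩ := hS hf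
  exact ⟨u, v, rfl⟩

end BinomialIdeals

section Exponents

variable {ι : Type*}

/-- The inclusion `ℕ^ι → ℤ^ι` of exponents into integer vectors. -/
noncomputable def toInt : (ι →₀ ℕ) →+ (ι → ℤ) where
  toFun u i := u i
  map_zero' := rfl
  map_add' _ _ := funext fun _ => Nat.cast_add _ _

theorem toInt_injective : Function.Injective (toInt (ι := ι)) := fun _ _ h =>
  Finsupp.ext fun i => Int.ofNat_inj.1 (congrFun h i)

theorem exists_toInt_eq [Finite ι] {u : ι → ℤ} (hu : 0 ≤ u) : ∃ p, toInt p = u :=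
  ⟨Finsupp.equivFunOnFinite.symm fun i => (u i).toNat, funext fun i => Int.toNat_of_nonneg (hu i)⟩

/-- The restriction of exponents to the coordinates outside `s`. -/
noncomputable def restrict (s : Set ι) : (ι →₀ ℕ) →+ ({i // i ∉ s} →₀ ℕ) :=
  Finsupp.subtypeDomainAddMonoidHom

theorem outside_toInt (s : Set ι) (u : ι →₀ ℕ) : outside s (toInt u) = toInt (restrict s u) :=
  rfl

theorem restrict_surjective (s : Set ι) : Function.Surjective (restrict s) := fun a => by
  classical exact ⟨a.extendDomain, Finsupp.subtypeDomain_extendDomain a⟩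

theorem ker_restrict_le_modCon (s : Set ι) (c : AddCon (ι →₀ ℕ)) :
    AddCon.ker (restrict s) ≤ modCon c (AddMonoidHom.mker (restrict s)) := by
  intro u v h
  have agree (i) (hi : i ∉ s) : u i = v i := DFunLike.congr_fun h ⟨i, hi⟩
  have sub_mem {a b : ι →₀ ℕ} (h : ∀ i ∉ s, a i = b i) : restrict s (a - b) = 0 :=
    Finsupp.ext fun i => tsub_eq_zero_of_le (h i i.2).le
  refine ⟨v - u, sub_mem fun i hi => (agree i hi).symm, u - v, sub_mem agree, ?_⟩
  have hsum : u + (v - u) = v + (u - v) := by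
    ext i
    simp only [Finsupp.add_apply, Finsupp.tsub_apply]
    omega
  exact hsum ▸ c.refl _

/-- The congruence of a lattice: exponents are identified if they differ by a lattice vector. -/
noncomputable def latticeCon (L : AddSubgroup (ι → ℤ)) : AddCon (ι →₀ ℕ) :=
  AddCon.ker ((QuotientAddGroup.mk' L).comp toInt)

variable {L : AddSubgroup (ι → ℤ)} {u v : ι →₀ ℕ}

theorem latticeCon_iff : latticeCon L u v ↔ toInt u - toInt v ∈ L :=
  QuotientAddGroup.eq_iff_sub_mem

theorem latticeCon_zero_iff : latticeCon L u 0 ↔ toInt u ∈ L := by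
  rw [latticeCon_iff, map_zero, sub_zero]

theorem latticeCon_restrict (h : latticeCon L u v) :
    latticeCon (projOutside L) (restrict (sigma L) u) (restrict (sigma L) v) := by
  rw [latticeCon_iff] at h ⊢
  exact ⟨_, h, map_sub _ _ _⟩

theorem latticeIdeal_eq_conIdeal (k : Type*) [Field k] (L : AddSubgroup (ι → ℤ)) :
    latticeIdeal k L = conIdeal k (latticeCon L) := by
  simp only [conIdeal, latticeCon_iff]
  rfl

theorem latticeCon_closure_le {B : Set (ι →₀ ℕ)} {c : AddCon (ι →₀ ℕ)} (hB : ∀ b ∈ B, c b 0) :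
    latticeCon (AddSubgroup.closure (toInt '' B)) ≤ c := by
  have key : ∀ z ∈ AddSubgroup.closure (toInt '' B), ∃ s t, c s 0 ∧ c t 0 ∧
      toInt s - toInt t = z := by
    intro z hz
    induction hz using AddSubgroup.closure_induction with
    | mem z hz =>
      obtain ⟨b, hb, rfl⟩ := hz
      exact ⟨b, 0, hB b hb, c.refl 0, by rw [map_zero, sub_zero]⟩
    | zero => exact ⟨0, 0, c.refl 0, c.refl 0, sub_self _⟩
    | add _ _ _ _ hx hy =>
      obtain ⟨s, t, hs, ht, rfl⟩ := hx
      obtain ⟨s', t', hs', ht', rfl⟩ := hy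
      refine ⟨s + s', t + t', ?_, ?_, by rw [map_add, map_add, add_sub_add_comm]⟩
      · simpa only [add_zero] using c.add hs hs'
      · simpa only [add_zero] using c.add ht ht'
    | neg _ _ hx =>
      obtain ⟨s, t, hs, ht, rfl⟩ := hx
      exact ⟨t, s, ht, hs, (neg_sub _ _).symm⟩
  intro u v huv
  obtain ⟨s, t, hs, ht, hst⟩ := key _ (latticeCon_iff.1 huv)
  have hsum : u + t = v + s := toInt_injective <| by
    rw [map_add, map_add, add_comm (toInt v), ← sub_eq_sub_iff_add_eq_add, hst]
  have absorb {w r : ι →₀ ℕ} (hr : c r 0) : c (w + r) w := by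
    simpa only [add_zero] using c.add (c.refl w) hr
  exact c.trans (c.symm (absorb ht)) (hsum ▸ absorb hs)

end Exponents

section NonnegativeVectors

variable {ι : Type*} {L : AddSubgroup (ι → ℤ)}

theorem eq_zero_of_mem_plus {u : ι → ℤ} (hu : u ∈ plus L) {i : ι} (hi : i ∉ sigma L) : u i = 0 := by
  by_contra h
  exact hi (Set.mem_iUnion₂.2 ⟨u, hu, h⟩)

variable [Finite ι]

theorem exists_nonneg_add_nsmul {s : Set ι} {u w : ι → ℤ} (hu : ∀ i ∉ s, 0 ≤ u i) (hw : 0 ≤ w)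
    (hpos : ∀ i ∈ s, 0 < w i) : ∃ N : ℕ, 0 ≤ u + N • w := by
  have eventually_nonneg (i : ι) : ∀ᶠ N : ℕ in Filter.atTop, 0 ≤ u i + N • w i := by
    filter_upwards [Filter.eventually_ge_atTop (u i).natAbs] with N hN
    by_cases hi : i ∈ s
    · have hwi := hpos i hi
      have huN : -u i ≤ N := by omega
      rw [nsmul_eq_mul]
      nlinarith
    · exact add_nonneg (hu i hi) (nsmul_nonneg (hw i) N)
  exact (Filter.eventually_all.2 eventually_nonneg).exists

variable (L) in
theorem exists_mem_plus_pos : ∃ w ∈ plus L, ∀ i ∈ sigma L, 0 < w i := by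
  have := Fintype.ofFinite ι
  have pos_at (i : ι) : ∃ u ∈ plus L, i ∈ sigma L → 0 < u i := by
    by_cases hi : i ∈ sigma L
    · obtain ⟨u, hu, hui⟩ := Set.mem_iUnion₂.1 hi
      exact ⟨u, hu, fun _ => lt_of_le_of_ne (hu.2 i) (Ne.symm hui)⟩
    · exact ⟨0, ⟨L.zero_mem, fun _ => le_rfl⟩, fun h => absurd h hi⟩
  choose u hu hpos using pos_at
  refine ⟨∑ i, u i, ⟨L.sum_mem fun i _ => (hu i).1, fun j => ?_⟩, fun j hj => ?_⟩ <;>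
    rw [Finset.sum_apply]
  · exact Finset.sum_nonneg fun i _ => (hu i).2 j
  · exact Finset.sum_pos' (fun i _ => (hu i).2 j) ⟨j, Finset.mem_univ j, hpos j hj⟩

theorem exists_add_mem_plus {u : ι → ℤ} (hu : u ∈ L) (hu0 : ∀ i ∉ sigma L, 0 ≤ u i) :
    ∃ w ∈ plus L, u + w ∈ plus L := by
  obtain ⟨w, hw, hpos⟩ := exists_mem_plus_pos L
  obtain ⟨N, hN⟩ := exists_nonneg_add_nsmul hu0 hw.2 hpos
  have hNw : N • w ∈ L := L.nsmul_mem hw.1 N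
  exact ⟨N • w, ⟨hNw, fun i => nsmul_nonneg (hw.2 i) N⟩, L.add_mem hu hNw, hN⟩

variable (L) in
theorem isPositivelyGraded_projOutside : IsPositivelyGraded (projOutside L) := by
  refine Set.Subset.antisymm ?_ (Set.singleton_subset_iff.2 ⟨zero_mem _, fun _ => le_rfl⟩)
  rintro _ ⟨⟨u, hu, rfl⟩, hnonneg⟩
  obtain ⟨w, hw, huw⟩ := exists_add_mem_plus hu fun i hi => hnonneg ⟨i, hi⟩
  refine funext fun i => ?_
  have hsum : u i + w i = 0 := eq_zero_of_mem_plus huw i.2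
  rwa [eq_zero_of_mem_plus hw i.2, add_zero] at hsum

theorem mem_purePart {u : ι → ℤ} : u ∈ purePart L ↔ u ∈ L ∧ ∀ i ∉ sigma L, u i = 0 := by
  refine ⟨fun hu => ⟨(AddSubgroup.closure_le L).2 (fun _ h => h.1) hu, fun i hi => ?_⟩, ?_⟩
  · have hle : purePart L ≤ (Pi.evalAddMonoidHom (fun _ : ι => ℤ) i).ker :=
      (AddSubgroup.closure_le _).2 fun v hv => eq_zero_of_mem_plus hv hi
    exact hle hu
  · rintro ⟨hu, hu0⟩
    obtain ⟨w, hw, huw⟩ := exists_add_mem_plus hu fun i hi => (hu0 i hi).ge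
    rw [← add_sub_cancel_right u w]
    exact sub_mem (AddSubgroup.subset_closure huw) (AddSubgroup.subset_closure hw)

end NonnegativeVectors

section NonnegativeBasis

open Module

theorem exists_basis_smul_eq {R M : Type*} [CommRing R] [IsDomain R] [IsPrincipalIdealRing R]
    [AddCommGroup M] [Module R M] [Module.Free R M] [Module.Finite R M] {w : M} (hw : w ≠ 0) :
    ∃ (b : Basis (Fin (finrank R M)) R M) (j : _) (d : R), w = d • b j := by
  obtain ⟨n, snf⟩ := (Submodule.span R {w}).smithNormalForm (finBasis R M)
  have hrank : finrank R (Submodule.span R {w}) = 1 := by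
    rw [← (LinearEquiv.toSpanNonzeroSingleton R M w hw).finrank_eq, finrank_self]
  obtain rfl : n = 1 := by rw [← hrank, finrank_eq_card_basis snf.bN, Fintype.card_fin]
  refine ⟨snf.bM, snf.f 0, snf.bN.repr ⟨w, Submodule.mem_span_singleton_self w⟩ 0 * snf.a 0, ?_⟩
  have hrepr := congrArg Subtype.val
    (snf.bN.sum_repr ⟨w, Submodule.mem_span_singleton_self w⟩).symm
  simpa [snf.snf, mul_smul] using hrepr

theorem exists_basis_nsmul_eq {M : Type*} [AddCommGroup M] [Module.Free ℤ M] [Module.Finite ℤ M]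
    {w : M} (hw : w ≠ 0) :
    ∃ (b : Basis (Fin (finrank ℤ M)) ℤ M) (j : _) (n : ℕ), w = n • b j := by
  obtain ⟨b, j, d, hd⟩ := exists_basis_smul_eq (R := ℤ) hw
  obtain ⟨n, rfl | rfl⟩ := d.eq_nat_or_neg
  · exact ⟨b, j, n, by rw [hd, natCast_zsmul]⟩
  · exact ⟨b.map (LinearEquiv.neg ℤ), j, n, by simp [hd]⟩

theorem closure_range_le_closure_range_add_nsmul {G α : Type*} [AddCommGroup G] (b : α → G)
    {j : α} {N : α → ℕ} (hj : N j = 0) :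
    AddSubgroup.closure (Set.range b) ≤
      AddSubgroup.closure (Set.range fun i => b i + N i • b j) := by
  set C := AddSubgroup.closure (Set.range fun i => b i + N i • b j)
  have mem (i : α) : b i + N i • b j ∈ C := AddSubgroup.subset_closure ⟨i, rfl⟩
  have mem_j : b j ∈ C := by simpa only [hj, zero_nsmul, add_zero] using mem j
  rw [AddSubgroup.closure_le]
  rintro _ ⟨i, rfl⟩
  exact (add_mem_cancel_right (nsmul_mem mem_j (N i))).1 (mem i)

variable {ι : Type*} [Finite ι]

instance finite_addSubgroup (M : AddSubgroup (ι → ℤ)) : Module.Finite ℤ M :=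
  inferInstanceAs (Module.Finite ℤ (AddSubgroup.toIntSubmodule M))

variable (L : AddSubgroup (ι → ℤ))

theorem exists_basis_purePart_pos (hne : (sigma L).Nonempty) :
    ∃ (b : Basis (Fin (finrank ℤ (purePart L))) ℤ (purePart L)) (j : _),
      ∀ i ∈ sigma L, 0 < (b j : ι → ℤ) i := by
  obtain ⟨w, hw, hpos⟩ := exists_mem_plus_pos L
  obtain ⟨i₀, hi₀⟩ := hne
  let w' : purePart L := ⟨w, AddSubgroup.subset_closure hw⟩
  have hw' : w' ≠ 0 := fun h => (hpos i₀ hi₀).ne' (congrFun (congrArg Subtype.val h) i₀)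
  obtain ⟨b, j, n, hn⟩ := exists_basis_nsmul_eq hw'
  refine ⟨b, j, fun i hi => ?_⟩
  have hwi : w i = n • (b j : ι → ℤ) i := congrFun (congrArg Subtype.val hn) i
  rw [nsmul_eq_mul] at hwi
  exact pos_of_mul_pos_right (hwi ▸ hpos i hi) n.cast_nonneg

theorem exists_generators_purePart : ∃ g : Fin (finrank ℤ (purePart L)) → ι →₀ ℕ,
    AddSubgroup.closure (toInt '' Set.range g) = purePart L := by
  rcases (sigma L).eq_empty_or_nonempty with hempty | hne
  · have hbot : purePart L = ⊥ := (AddSubgroup.eq_bot_iff_forall _).2 fun u hu =>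
      funext fun i => (mem_purePart.1 hu).2 i (by simp [hempty])
    refine ⟨0, hbot ▸ AddSubgroup.closure_eq_bot_iff.2 ?_⟩
    rintro _ ⟨_, ⟨i, rfl⟩, rfl⟩
    exact map_zero toInt
  obtain ⟨b, j, hpos⟩ := exists_basis_purePart_pos L hne
  have off (i) : ∀ a ∉ sigma L, (b i : ι → ℤ) a = 0 := (mem_purePart.1 (b i).2).2
  have hbj : 0 ≤ (b j : ι → ℤ) := fun a => by
    by_cases ha : a ∈ sigma L
    exacts [(hpos a ha).le, (off j a ha).ge]
  have shift (i) : ∃ N : ℕ, 0 ≤ (b i : ι → ℤ) + N • (b j : ι → ℤ) ∧ (i = j → N = 0) := by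
    rcases eq_or_ne i j with rfl | hij
    · exact ⟨0, by simpa using hbj, fun _ => rfl⟩
    · obtain ⟨N, hN⟩ := exists_nonneg_add_nsmul (fun a ha => (off i a ha).ge) hbj hpos
      exact ⟨N, hN, fun h => absurd h hij⟩
  choose N hN hNj using shift
  choose g hg using fun i => exists_toInt_eq (hN i)
  refine ⟨g, ?_⟩
  rw [← Set.range_comp, show toInt ∘ g = _ from funext hg]
  refine le_antisymm ((AddSubgroup.closure_le _).2 ?_) fun x hx => ?_
  · rintro _ ⟨i, rfl⟩
    exact add_mem (b i).2 (nsmul_mem (b j).2 _)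
  · refine closure_range_le_closure_range_add_nsmul (fun i => (b i : ι → ℤ)) (hNj j rfl) ?_
    have hx_sum : x = ∑ i, b.repr ⟨x, hx⟩ i • (b i : ι → ℤ) := by
      simpa only [AddSubgroup.val_finsetSum, AddSubgroupClass.coe_zsmul] using
        congrArg Subtype.val (b.sum_repr ⟨x, hx⟩).symm
    rw [hx_sum]
    exact sum_mem fun i _ => zsmul_mem (AddSubgroup.subset_closure (Set.mem_range_self i)) _

end NonnegativeBasis

section Ranks

variable {ι : Type*} [Finite ι]

theorem finrank_le_encard_of_le_closure {M : AddSubgroup (ι → ℤ)} {D : Set (ι → ℤ)}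
    (h : M ≤ AddSubgroup.closure D) : (Module.finrank ℤ M : ℕ∞) ≤ D.encard := by
  rcases D.finite_or_infinite with hD | hD
  · have := hD.fintype
    have hspan : AddSubgroup.toIntSubmodule M ≤ Submodule.span ℤ D := fun x hx => by
      have hxD := h hx
      rwa [← Submodule.span_int_eq_addSubgroupClosure] at hxD
    rw [Set.encard_eq_coe_toFinset_card, Nat.cast_le]
    exact (Submodule.finrank_mono hspan).trans (finrank_span_le_card D)
  · rw [hD.encard_eq]
    exact le_top

variable {L : AddSubgroup (ι → ℤ)} {u v : ι →₀ ℕ}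

theorem exists_add_rel_of_latticeCon_restrict
    (h : latticeCon (projOutside L) (restrict (sigma L) u) (restrict (sigma L) v)) :
    ∃ p, restrict (sigma L) p = 0 ∧ latticeCon L (u + p) v := by
  obtain ⟨z, hz, hzuv⟩ := latticeCon_iff.1 h
  obtain ⟨w, hw, hpos⟩ := exists_mem_plus_pos L
  have off (i) (hi : i ∉ sigma L) : (z - (toInt u - toInt v)) i = 0 :=
    sub_eq_zero.2 (congrFun hzuv ⟨i, hi⟩)
  obtain ⟨N, hN⟩ := exists_nonneg_add_nsmul (fun i hi => (off i hi).ge) hw.2 hpos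
  obtain ⟨p, hp⟩ := exists_toInt_eq hN
  refine ⟨p, toInt_injective ?_, ?_⟩
  · rw [← outside_toInt, map_zero, hp]
    refine funext fun i => ?_
    change (z - (toInt u - toInt v)) i + N • w i = 0
    rw [off i i.2, eq_zero_of_mem_plus hw i.2, nsmul_zero, add_zero]
  · rw [latticeCon_iff, map_add, hp]
    convert L.add_mem hz (L.nsmul_mem hw.1 N) using 1
    abel

theorem restrict_eq_zero_iff_of_latticeCon (h : latticeCon L u v) :
    restrict (sigma L) u = 0 ↔ restrict (sigma L) v = 0 := by
  have eq_zero {a : {i // i ∉ sigma L} →₀ ℕ} (ha : latticeCon (projOutside L) a 0) : a = 0 := by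
    have mem_plus : toInt a ∈ plus (projOutside L) :=
      ⟨latticeCon_zero_iff.1 ha, fun i => Int.natCast_nonneg (a i)⟩
    rw [isPositivelyGraded_projOutside L] at mem_plus
    exact toInt_injective mem_plus
  have huv := latticeCon_restrict h
  exact ⟨fun hu => eq_zero (hu ▸ AddCon.symm _ huv), fun hv => eq_zero (hv ▸ huv)⟩

theorem conSpan_image_restrict {R : Set ((ι →₀ ℕ) × (ι →₀ ℕ))} (hR : conSpan R = latticeCon L) :
    conSpan (Prod.map (restrict (sigma L)) (restrict (sigma L)) ''
      (R \ {p ∈ R | restrict (sigma L) p.1 = 0})) = latticeCon (projOutside L) := by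
  have hRL : ∀ p ∈ R, latticeCon L p.1 p.2 := conSpan_le.1 hR.le
  refine le_antisymm (conSpan_le.2 ?_) fun a b hab => ?_
  · rintro _ ⟨p, ⟨hp, -⟩, rfl⟩
    exact latticeCon_restrict (hRL p hp)
  obtain ⟨u, rfl⟩ := restrict_surjective _ a
  obtain ⟨v, rfl⟩ := restrict_surjective _ b
  obtain ⟨p, hp, hpv⟩ := exists_add_rel_of_latticeCon_restrict hab
  set d := conSpan (Prod.map (restrict (sigma L)) (restrict (sigma L)) ''
    (R \ {p ∈ R | restrict (sigma L) p.1 = 0}))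
  have hle : latticeCon L ≤ d.comap (restrict (sigma L)) (map_add _) := by
    rw [← hR, conSpan_le]
    intro q hq
    change d (restrict (sigma L) q.1) (restrict (sigma L) q.2)
    by_cases h0 : restrict (sigma L) q.1 = 0
    · rw [h0, (restrict_eq_zero_iff_of_latticeCon (hRL q hq)).1 h0]
      exact d.refl 0
    · have hqR : q ∈ R \ {p ∈ R | restrict (sigma L) p.1 = 0} := ⟨hq, fun h => h0 h.2⟩
      exact conSpan_of_mem (Set.mem_image_of_mem _ hqR)
  have hd : d (restrict (sigma L) (u + p)) (restrict (sigma L) v) := hle hpv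
  rwa [map_add, hp, add_zero] at hd

theorem finrank_purePart_le_encard {R : Set ((ι →₀ ℕ) × (ι →₀ ℕ))}
    (hR : conSpan R = latticeCon L) :
    (Module.finrank ℤ (purePart L) : ℕ∞) ≤ {p ∈ R | restrict (sigma L) p.1 = 0}.encard := by
  set R₀ := {p ∈ R | restrict (sigma L) p.1 = 0}
  let D : Set (ι → ℤ) := (fun p => toInt p.1 - toInt p.2) '' R₀
  have hface (a b : ι →₀ ℕ) (h : a + b ∈ AddMonoidHom.mker (restrict (sigma L))) :
      a ∈ AddMonoidHom.mker (restrict (sigma L)) ∧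
        b ∈ AddMonoidHom.mker (restrict (sigma L)) := by
    rwa [AddMonoidHom.mem_mker, map_add, add_eq_zero] at h
  have hR₀ : conSpan R₀ ≤ latticeCon (AddSubgroup.closure D) :=
    conSpan_le.2 fun p hp => latticeCon_iff.2 (AddSubgroup.subset_closure ⟨p, hp, rfl⟩)
  have hpure : purePart L ≤ AddSubgroup.closure D := (AddSubgroup.closure_le _).2 fun u hu => by
    obtain ⟨p, rfl⟩ := exists_toInt_eq hu.2
    have hp : conSpan R p 0 := hR ▸ latticeCon_zero_iff.2 hu.1
    obtain ⟨hiff, hrel⟩ := conSpan_restrict_face hface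
      (fun q hq => restrict_eq_zero_iff_of_latticeCon (conSpan_le.1 hR.le q hq)) hp
    exact latticeCon_zero_iff.1 (hR₀ (hrel (hiff.2 (zero_mem _))))
  exact (finrank_le_encard_of_le_closure hpure).trans (Set.encard_image_le _ _)

theorem conRank_projOutside_add_finrank_le :
    conRank (latticeCon (projOutside L)) + (Module.finrank ℤ (purePart L) : ℕ∞) ≤
      conRank (latticeCon L) := by
  refine le_iInf fun ⟨R, hR⟩ => ?_
  change _ ≤ R.encard
  rw [← Set.encard_sdiff_add_encard_of_subset
    (Set.sep_subset R fun p => restrict (sigma L) p.1 = 0), ← conSpan_image_restrict hR]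
  exact add_le_add ((conRank_conSpan_le _).trans (Set.encard_image_le _ _))
    (finrank_purePart_le_encard hR)

theorem exists_add_rel_zero {c : AddCon (ι →₀ ℕ)} (hc : latticeCon (purePart L) ≤ c)
    (hu : restrict (sigma L) u = 0) : ∃ u', c (u + u') 0 := by
  obtain ⟨w, hw, hpos⟩ := exists_mem_plus_pos L
  have off (i) (hi : i ∉ sigma L) : 0 ≤ (-toInt u) i := by
    have hui : u i = 0 := DFunLike.congr_fun hu ⟨i, hi⟩
    simp [toInt, hui]
  obtain ⟨N, hN⟩ := exists_nonneg_add_nsmul off hw.2 hpos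
  obtain ⟨u', hu'⟩ := exists_toInt_eq hN
  refine ⟨u', hc (latticeCon_zero_iff.2 ?_)⟩
  rw [map_add, hu', add_neg_cancel_left]
  exact nsmul_mem (AddSubgroup.subset_closure hw) N

theorem latticeCon_le_of_le_modCon {c : AddCon (ι →₀ ℕ)} (hcL : c ≤ latticeCon L)
    (hpure : latticeCon (purePart L) ≤ c)
    (hmod : latticeCon L ≤ modCon c (AddMonoidHom.mker (restrict (sigma L)))) :
    latticeCon L ≤ c := by
  intro u v huv
  obtain ⟨s, hs, t, ht, hst⟩ := hmod huv
  have hts : latticeCon (purePart L) t s := by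
    rw [latticeCon_iff, mem_purePart]
    constructor
    · convert sub_mem (latticeCon_iff.1 huv) (latticeCon_iff.1 (hcL hst)) using 1
      rw [map_add, map_add]
      abel
    · intro i hi
      have hti : t i = s i := DFunLike.congr_fun (ht.trans hs.symm) ⟨i, hi⟩
      exact sub_eq_zero.2 (congrArg Nat.cast hti)
  obtain ⟨s', hs'⟩ := exists_add_rel_zero hpure hs
  exact rel_of_add_rel_add hs' (c.trans hst (c.add (c.refl v) (hpure hts)))

theorem exists_lift_generators {T : Set (({i // i ∉ sigma L} →₀ ℕ) × ({i // i ∉ sigma L} →₀ ℕ))}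
    (hT : conSpan T ≤ latticeCon (projOutside L)) :
    ∃ R : Set ((ι →₀ ℕ) × (ι →₀ ℕ)), conSpan R ≤ latticeCon L ∧ R.encard = T.encard ∧
      Prod.map (restrict (sigma L)) (restrict (sigma L)) '' R = T := by
  have hsurj : Set.SurjOn (Prod.map (restrict (sigma L)) (restrict (sigma L)))
      {p | latticeCon L p.1 p.2} T := by
    rintro ⟨a, b⟩ hab
    obtain ⟨u, rfl⟩ := restrict_surjective _ a
    obtain ⟨v, rfl⟩ := restrict_surjective _ b
    obtain ⟨p, hp, hpv⟩ := exists_add_rel_of_latticeCon_restrict (conSpan_le.1 hT _ hab)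
    exact ⟨(u + p, v), hpv, Prod.ext (by simp [hp]) rfl⟩
  obtain ⟨R, hRL, hR⟩ := hsurj.exists_bijOn_subset
  exact ⟨R, conSpan_le.2 hRL, by rw [← hR.image_eq, hR.injOn.encard_image], hR.image_eq⟩

theorem conSpan_union_eq_latticeCon {R : Set ((ι →₀ ℕ) × (ι →₀ ℕ))} {B : Set (ι →₀ ℕ)}
    (hR : conSpan R ≤ latticeCon L)
    (hRL : conSpan (Prod.map (restrict (sigma L)) (restrict (sigma L)) '' R) =
      latticeCon (projOutside L))
    (hB : AddSubgroup.closure (toInt '' B) = purePart L) :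
    conSpan (R ∪ (fun b => (b, 0)) '' B) = latticeCon L := by
  set c := conSpan (R ∪ (fun b => (b, 0)) '' B)
  have hRc : conSpan R ≤ c := conSpan_le.2 fun p hp => conSpan_of_mem (Or.inl hp)
  have hcL : c ≤ latticeCon L := by
    rw [conSpan_le]
    rintro _ (hp | ⟨b, hb, rfl⟩)
    · exact conSpan_le.1 hR _ hp
    · have hbL : toInt b ∈ purePart L := hB ▸ AddSubgroup.subset_closure ⟨b, hb, rfl⟩
      exact latticeCon_zero_iff.2 (mem_purePart.1 hbL).1
  have hpure : latticeCon (purePart L) ≤ c := by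
    rw [← hB]
    exact latticeCon_closure_le fun b hb =>
      conSpan_of_mem (p := (b, 0)) (Or.inr (Set.mem_image_of_mem _ hb))
  refine le_antisymm hcL (latticeCon_le_of_le_modCon hcL hpure fun u v huv => ?_)
  refine rel_of_conSpan_image (restrict_surjective (sigma L)) (ker_restrict_le_modCon _ c)
    (hRc.trans (le_modCon c _)) ?_
  rw [hRL]
  exact latticeCon_restrict huv

theorem conRank_le_conRank_projOutside_add_finrank :
    conRank (latticeCon L) ≤
      conRank (latticeCon (projOutside L)) + (Module.finrank ℤ (purePart L) : ℕ∞) := by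
  obtain ⟨g, hg⟩ := exists_generators_purePart L
  have hg_card : (Set.range g).encard ≤ Module.finrank ℤ (purePart L) := by
    rw [← Set.image_univ]
    exact (Set.encard_image_le _ _).trans (by simp [Set.encard_univ])
  rw [conRank.eq_def (latticeCon (projOutside L)), ENat.iInf_add]
  refine le_iInf fun ⟨T, hT⟩ => ?_
  obtain ⟨R, hRL, hRcard, rfl⟩ := exists_lift_generators hT.le
  calc conRank (latticeCon L)
      ≤ (R ∪ (fun b => (b, 0)) '' Set.range g).encard := by
        have := conRank_conSpan_le (R ∪ (fun b => (b, 0)) '' Set.range g)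
        rwa [conSpan_union_eq_latticeCon hRL hT hg] at this
    _ ≤ R.encard + ((fun b => (b, 0)) '' Set.range g).encard := Set.encard_union_le _ _
    _ ≤ _ := add_le_add hRcard.le ((Set.encard_image_le _ _).trans hg_card)

end Ranks

end BinomialLattice

open BinomialLattice in
theorem theorem5p4_general (k : Type*) [Field k] {ι : Type*} [Finite ι] (L : AddSubgroup (ι → ℤ)) :
    IsPositivelyGraded (projOutside L) ∧ mu (latticeIdeal k L) ≠ ⊤ ∧
    mu (latticeIdeal k (projOutside L)) ≠ ⊤ ∧
    mu (latticeIdeal k L) =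
      mu (latticeIdeal k (projOutside L)) + (Module.finrank ℤ (purePart L) : ℕ∞) := by
  simp only [latticeIdeal_eq_conIdeal]
  refine ⟨isPositivelyGraded_projOutside L, mu_conIdeal_ne_top _, mu_conIdeal_ne_top _, ?_⟩
  rw [mu_conIdeal, mu_conIdeal]
  exact le_antisymm conRank_le_conRank_projOutside_add_finrank conRank_projOutside_add_finrank_le

theorem theorem5p4 (k : Type*) [Field k] (n : ℕ) (L : AddSubgroup (Fin n → ℤ)) :
    BinomialLattice.IsPositivelyGraded (BinomialLattice.projOutside L) ∧
    BinomialLattice.mu (BinomialLattice.latticeIdeal k L) ≠ ⊤ ∧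
    BinomialLattice.mu (BinomialLattice.latticeIdeal k (BinomialLattice.projOutside L)) ≠ ⊤ ∧
    BinomialLattice.mu (BinomialLattice.latticeIdeal k L) =
      BinomialLattice.mu (BinomialLattice.latticeIdeal k (BinomialLattice.projOutside L)) +
        (Module.finrank ℤ (BinomialLattice.purePart L) : ℕ∞) :=
  theorem5p4_general k L
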